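/- Let $\Delta$ be an $n$-dimensional simplex in $\mathbb{R}^n$ (the convex hull of $n+1$ affinely independent points), and let $K$ be a compact convex set in $\mathbb{R}^n$. For a unit vector $u$ and a set $A\subseteq\mathbb{R}^n$, write $A_u$ for the orthogonal projection of $A$ onto the hyperplane $u^\perp$, and write $V_n$ for $n$-dimensional volume. Suppose that (i) for every unit vector $u$, the projection $\Delta_u$ contains a translate of $K_u$, and (ii) $\Delta$ does not contain a translate of $K$. Then there exists $t\in(0,1)$ such that $L=(1-t)K+t\Delta=\{(1-t)x+ty : x\in K,\ y\in\Delta\}$ is a convex body (a non-empty compact convex set) for which (i') for every unit vector $u$, the projection $\Delta_u$ contains a translate of $L_u$, and (ii') $V_n(L)>V_n(\Delta)$. -/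

import Mathlib

open MeasureTheory Set
open scoped Pointwise

/-- Euclidean space of dimension `n`. -/
abbrev Euc (n : ℕ) : Type := EuclideanSpace ℝ (Fin n)

/-- The shadow `K_u`: the orthogonal projection of `K` onto the hyperplane `u^⊥`,
as a subset of that hyperplane. -/
noncomputable def shadow {n : ℕ} (u : Euc n) (K : Set (Euc n)) : Set (Submodule.span ℝ {u})ᗮ :=
  (Submodule.span ℝ {u})ᗮ.orthogonalProjectionOnto '' K

/-- `A` contains a translate of `B`. -/
def ContainsTranslate {E : Type*} [AddCommGroup E] (A B : Set E) : Prop :=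
  ∃ w : E, (fun x => x + w) '' B ⊆ A

/-- Every shadow of `A` contains a translate of the corresponding shadow of `B`. -/
def ShadowsContainTranslates {n : ℕ} (A B : Set (Euc n)) : Prop :=
  ∀ u : Euc n, ‖u‖ = 1 → ContainsTranslate (shadow u A) (shadow u B)

/-- The solid simplex: the convex hull of its `n + 1` affinely independent vertices. -/
def solidSimplex {n : ℕ} (s : Affine.Simplex ℝ (Euc n) n) : Set (Euc n) :=
  convexHull ℝ (Set.range s.points)

open scoped ENNReal Topology

namespace AffineBasis

/-! ### Barycentric coordinates under translation and convex combination. -/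

variable {ι E : Type*} [NormedAddCommGroup E] [NormedSpace ℝ E] (b : AffineBasis ι ℝ E)

/-! If no translate of `K` fits in Δ, the minima of the barycentric coordinates over `K`, attained
at points `x i`, sum to some `-δ < 0` (`exists_min_coord`). Pushing each facet of Δ out to its
minimum scaled by `ε` gives a simplex `T` of ratio `1 + εδ`, a first-order volume gain
(`le_measure_coord_ge`). The body `εK + (1 - ε)Δ` contains every `ε x i + (1 - ε)Δ`, so it misses
only points of `T` near two facets, of measure `O(ε²)` (`exists_measure_near_two_facets_le`). Small
`ε` wins; shadows survive by convexity. -/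

theorem coord_combo (i : ι) (x y : E) (t : ℝ) :
    b.coord i ((1 - t) • x + t • y) = (1 - t) * b.coord i x + t * b.coord i y := by
  have h := (b.coord i).apply_lineMap x y t
  simpa [AffineMap.lineMap_apply_module] using h

theorem coord_smul_point (i : ι) (x : E) (t : ℝ) :
    b.coord i (t • x) = (1 - t) * b.coord i 0 + t * b.coord i x := by
  simpa using b.coord_combo i 0 x t

variable [Fintype ι]

/-- Translations realise every shift of the barycentric coordinates of total zero. -/
theorem exists_coord_add_eq (c : ι → ℝ) (hc : ∑ i, c i = 0) :
    ∃ v : E, ∀ i x, b.coord i (x + v) = b.coord i x + c i := by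
  classical
  refine ⟨∑ k, c k • b k, fun i x => ?_⟩
  have h1 : ∀ w : E, (b.coord i).linear w = b.coord i w - b.coord i 0 := fun w => by
    have := (b.coord i).linearMap_vsub w 0
    simpa using this
  have h2 : (b.coord i).linear (∑ k, c k • b k) = c i := by
    have h3 : ∀ k, (b.coord i).linear (c k • b k) = c k * b.coord i (b k) - c k * b.coord i 0 :=
      fun k => by rw [map_smul, h1, smul_eq_mul, mul_sub]
    simp only [map_sum, h3, Finset.sum_sub_distrib, ← Finset.sum_mul, hc, b.coord_apply]
    simp
  have h3 := (b.coord i).map_vadd x (∑ k, c k • b k)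
  rw [h2] at h3
  simpa [add_comm] using h3

/-- Used to turn bounds on barycentric coordinates into boxes, whose volume is explicit. -/
theorem basisOf_repr_sub (l : ι) (x : E) (k : {k // k ≠ l}) :
    (b.basisOf l).repr (x - b l) k = b.coord k x := by
  classical
  have h : x - b l = ∑ k : {k // k ≠ l}, b.coord k x • b.basisOf l k := by
    simp only [basisOf_apply, vsub_eq_sub]
    have h1 : ∑ k, b.coord k x • (b k - b l) = x - b l := by
      simp only [smul_sub, Finset.sum_sub_distrib, ← Finset.sum_smul, b.sum_coord_apply_eq_one,
        one_smul, b.linear_combination_coord_eq_self]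
    rw [← h1, ← Finset.add_sum_erase _ _ (Finset.mem_univ l), sub_self, smul_zero, zero_add]
    exact Finset.sum_subtype _ (by simp) (fun k => b.coord k x • (b k - b l))
  rw [h, Module.Basis.repr_sum_self]

/-- A compact set no translate of which lies in the simplex has its minimal barycentric
coordinates summing to less than zero. -/
theorem exists_min_coord [FiniteDimensional ℝ E] {K : Set E} (hK : IsCompact K)
    (hnot : ¬ ∃ w : E, (fun x => x + w) '' K ⊆ convexHull ℝ (Set.range b)) :
    ∃ x : ι → E, (∀ i, x i ∈ K) ∧ (∑ i, b.coord i (x i)) < 0 := by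
  classical
  have hne : K.Nonempty := by
    by_contra h
    rw [Set.not_nonempty_iff_eq_empty] at h
    exact hnot ⟨0, by simp [h]⟩
  have hmin : ∀ i, ∃ x ∈ K, ∀ y ∈ K, b.coord i x ≤ b.coord i y := fun i =>
    hK.exists_isMinOn hne (b.coord i).continuous_of_finiteDimensional.continuousOn
  choose x hxK hx using hmin
  refine ⟨x, hxK, ?_⟩
  by_contra! hsum
  have := b.nonempty
  have hcard : (0 : ℝ) < Fintype.card ι := by exact_mod_cast Fintype.card_pos
  -- This shift makes all the minima equal to their average, which is nonnegative.
  obtain ⟨v, hv⟩ := b.exists_coord_add_eq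
    (fun i => (∑ j, b.coord j (x j)) / Fintype.card ι - b.coord i (x i)) (by
      rw [Finset.sum_sub_distrib, Finset.sum_const, Finset.card_univ, nsmul_eq_mul]
      field_simp
      simp)
  refine hnot ⟨v, ?_⟩
  rintro _ ⟨y, hy, rfl⟩
  rw [b.convexHull_eq_nonneg_coord]
  intro i
  rw [hv]
  have := hx i y hy
  have := div_nonneg hsum hcard.le
  linarith

/-! ### Volume estimates. -/

variable [MeasurableSpace E] [BorelSpace E] (μ : Measure E) [μ.IsAddHaarMeasure]

/-- Pushing all facets of a simplex outwards gives a set at least as large as the homothetic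
simplex. -/
theorem le_measure_coord_ge [FiniteDimensional ℝ E] (m : ι → ℝ) (hm : ∑ i, m i ≤ 0) :
    ENNReal.ofReal ((1 - ∑ i, m i) ^ Module.finrank ℝ E) * μ (convexHull ℝ (Set.range b)) ≤
      μ {x | ∀ i, m i ≤ b.coord i x} := by
  set r := 1 - ∑ i, m i with hr
  obtain ⟨v, hv⟩ := b.exists_coord_add_eq (fun i => m i + (r - 1) * b.coord i 0) (by
    rw [Finset.sum_add_distrib, ← Finset.mul_sum, b.sum_coord_apply_eq_one, hr]
    ring)
  have hpos : 0 ≤ r := by linarith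
  calc _ = μ ((fun x => x + v) '' (r • convexHull ℝ (Set.range b))) := by
        rw [Set.image_add_right, measure_preimage_add_right, Measure.addHaar_smul,
          abs_of_nonneg (pow_nonneg hpos _)]
    _ ≤ _ := by
        apply measure_mono
        rintro _ ⟨_, ⟨y, hy, rfl⟩, rfl⟩ i
        rw [b.convexHull_eq_nonneg_coord] at hy
        have := mul_nonneg hpos (hy i)
        simp only [hv, b.coord_smul_point]
        linarith

/-- The points of a slightly enlarged simplex that are `O(ε)`-close to two facets form a set of
measure `O(ε²)`. -/
theorem exists_measure_near_two_facets_le {i j : ι} (hij : i ≠ j) {R : ℝ} (hR : 0 ≤ R) :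
    ∃ C : ℝ≥0∞, C ≠ ∞ ∧ ∀ᶠ ε : ℝ in 𝓝[>] 0,
      μ {x | (∀ k, -(ε * R) ≤ b.coord k x) ∧ b.coord i x ≤ ε * R ∧ b.coord j x ≤ ε * R} ≤
        C * ENNReal.ofReal (ε ^ 2) := by
  classical
  by_cases hl : ∃ l, l ≠ i ∧ l ≠ j
  -- Eliminating a third coordinate `l` keeps both thin directions `i` and `j` as sides of the box.
  · obtain ⟨l, hli, hlj⟩ := hl
    let e := (b.basisOf l).equivFunL
    set ν := μ.map e with hν
    have : ν.IsAddHaarMeasure := e.isAddHaarMeasure_map μ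
    obtain ⟨c, hc⟩ : ∃ c : NNReal, ν = c • volume :=
      ⟨_, Measure.isAddLeftInvariant_eq_smul ν volume⟩
    let W : ℝ := 1 + Fintype.card ι * R
    let w : {k // k ≠ l} → ℝ := fun k => if (k : ι) = i ∨ (k : ι) = j then 2 * R else W + R
    have hW : 0 ≤ W + R := by positivity
    refine ⟨c * ENNReal.ofReal (∏ k, w k), by finiteness, ?_⟩
    filter_upwards [Ioo_mem_nhdsGT (zero_lt_one' ℝ)] with ε hε
    have hε0 := hε.1.le
    have hεR : ε * R ≤ R := mul_le_of_le_one_left hR hε.2.le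
    let lo : {k // k ≠ l} → ℝ := fun k => if (k : ι) = i ∨ (k : ι) = j then -(ε * R) else -R
    let hi : {k // k ≠ l} → ℝ := fun k => if (k : ι) = i ∨ (k : ι) = j then ε * R else W
    have hsub : {x | (∀ k, -(ε * R) ≤ b.coord k x) ∧ b.coord i x ≤ ε * R ∧ b.coord j x ≤ ε * R} ⊆
        (fun x => x + -b l) ⁻¹' (e ⁻¹' Set.Icc lo hi) := by
      rintro x ⟨h0, h1, h2⟩
      have he : ∀ k : {k // k ≠ l}, e (x + -b l) k = b.coord k x := fun k => by
        rw [← sub_eq_add_neg]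
        exact b.basisOf_repr_sub l x k
      have hup : ∀ k, b.coord k x ≤ W := fun k => by
        have hs := b.sum_coord_apply_eq_one x
        rw [← Finset.add_sum_erase _ _ (Finset.mem_univ k)] at hs
        have h3 : ∑ k' ∈ Finset.univ.erase k, (-R) ≤ ∑ k' ∈ Finset.univ.erase k, b.coord k' x :=
          Finset.sum_le_sum fun k' _ => by linarith [h0 k']
        rw [Finset.sum_const, nsmul_eq_mul] at h3
        have h4 : ((Finset.univ.erase k).card : ℝ) * R ≤ Fintype.card ι * R := by
          gcongr
          exact_mod_cast Finset.card_le_univ _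
        simp only [W]
        linarith
      simp only [Set.mem_preimage, Set.mem_Icc, Pi.le_def, he, lo, hi]
      refine ⟨fun k => ?_, fun k => ?_⟩
      · split_ifs
        · exact h0 k
        · linarith [h0 k]
      · split_ifs with h
        · rcases h with h | h <;> rw [h] <;> assumption
        · exact hup k
    have hprod : ∏ k, (hi k - lo k) = ε ^ 2 * ∏ k, w k := by
      have h5 : ∀ k, hi k - lo k = ((if k = ⟨i, hli.symm⟩ then ε else 1) *
          (if k = ⟨j, hlj.symm⟩ then ε else 1)) * w k := fun k => by
        simp only [hi, lo, w, Subtype.ext_iff]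
        by_cases h6 : (k : ι) = i
        · simp [h6, hij]; ring
        · by_cases h7 : (k : ι) = j
          · simp [h7, hij.symm]; ring
          · simp [h6, h7]
      simp only [h5, Finset.prod_mul_distrib, Finset.prod_ite_eq', Finset.mem_univ, if_true]
      ring
    have hw : 0 ≤ ∏ k, w k := Finset.prod_nonneg fun k _ => by
      simp only [w]; split_ifs <;> positivity
    calc _ ≤ _ := measure_mono hsub
      _ = ν (Set.Icc lo hi) := by
        rw [measure_preimage_add_right, hν,
          Measure.map_apply e.continuous.measurable measurableSet_Icc]
      _ = c * ENNReal.ofReal (∏ k, (hi k - lo k)) := by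
        rw [hc, Measure.smul_apply, Real.volume_Icc_pi, ENNReal.ofReal_prod_of_nonneg]
        · rfl
        · intro k _
          simp only [hi, lo]
          split_ifs
          · nlinarith
          · linarith
      _ = _ := by
        rw [hprod, ENNReal.ofReal_mul (by positivity), mul_assoc, mul_comm (ENNReal.ofReal (ε ^ 2))]
  -- With only two coordinates, their sum 1 prevents both from being small.
  · refine ⟨0, by simp, ?_⟩
    push Not at hl
    have htend : ∀ᶠ ε : ℝ in 𝓝[>] 0, 2 * (ε * R) < 1 := by
      apply Filter.Eventually.filter_mono nhdsWithin_le_nhds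
      have : Continuous fun ε : ℝ => 2 * (ε * R) := by fun_prop
      exact this.tendsto' 0 0 (by simp) |>.eventually_lt_const one_pos
    filter_upwards [htend] with ε hε
    rw [zero_mul, nonpos_iff_eq_zero]
    convert measure_empty (μ := μ)
    rw [Set.eq_empty_iff_forall_notMem]
    rintro x ⟨-, h1, h2⟩
    have hs := b.sum_coord_apply_eq_one x
    have hu : (Finset.univ : Finset ι) = {i, j} := by
      ext k
      simp only [Finset.mem_univ, Finset.mem_insert, Finset.mem_singleton, true_iff]
      by_cases h : k = i
      · exact Or.inl h
      · exact Or.inr (hl k h)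
    rw [hu, Finset.sum_pair hij] at hs
    linarith

/-- If a compact set has no translate inside a simplex, then moving the simplex slightly
towards that set increases its measure. -/
theorem eventually_measure_lt_combo [FiniteDimensional ℝ E] {K : Set E} (hK : IsCompact K) (hE : 0 < Module.finrank ℝ E)
    (hnot : ¬ ∃ w : E, (fun x => x + w) '' K ⊆ convexHull ℝ (Set.range b)) :
    ∀ᶠ ε : ℝ in 𝓝[>] 0, μ (convexHull ℝ (Set.range b)) <
      μ (ε • K + (1 - ε) • convexHull ℝ (Set.range b)) := by
  classical
  set Δ := convexHull ℝ (Set.range b) with hΔ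
  obtain ⟨x, hxK, hx⟩ := b.exists_min_coord hK hnot
  obtain ⟨R, hR⟩ := (Set.finite_range fun p : ι × ι => |b.coord p.2 (x p.1)|).bddAbove
  replace hR : ∀ i j, |b.coord j (x i)| ≤ R := fun i j => hR ⟨(i, j), rfl⟩
  have hR0 : 0 ≤ R := by
    have := b.nonempty
    exact (abs_nonneg _).trans (hR (Classical.arbitrary ι) (Classical.arbitrary ι))
  choose C hCtop hC using fun p : {p : ι × ι // p.1 ≠ p.2} =>
    b.exists_measure_near_two_facets_le μ p.2 hR0
  set δ := -∑ i, b.coord i (x i) with hδ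
  have hδ0 : 0 < δ := by linarith
  have hΔtop : μ Δ ≠ ∞ := ((Set.finite_range b).isCompact_convexHull ℝ).measure_ne_top
  have hΔpos : μ Δ ≠ 0 :=
    (Measure.measure_pos_of_nonempty_interior μ
      (interior_convexHull_nonempty_iff_affineSpan_eq_top.2 b.tot)).ne'
  have hCsum : ∑ p, C p ≠ ∞ := by simpa using hCtop
  have hsmall : ∀ᶠ ε : ℝ in 𝓝[>] 0, (∑ p, C p).toReal * ε < δ * (μ Δ).toReal := by
    apply Filter.Eventually.filter_mono nhdsWithin_le_nhds
    have : Continuous fun ε : ℝ => (∑ p, C p).toReal * ε := by fun_prop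
    exact this.tendsto' 0 0 (by simp) |>.eventually_lt_const
      (mul_pos hδ0 (ENNReal.toReal_pos hΔpos hΔtop))
  filter_upwards [hsmall, Filter.eventually_all.2 hC, Ioo_mem_nhdsGT (zero_lt_one' ℝ)]
    with ε hεsmall hεC hε
  obtain ⟨hε0, hε1⟩ := hε
  set L := ε • K + (1 - ε) • Δ
  set T := {y | ∀ i, ε * b.coord i (x i) ≤ b.coord i y}
  have hpiece : ∀ i y, (∀ j, ε * b.coord j (x i) ≤ b.coord j y) → y ∈ L := fun i y hy => by
    have h1 : 1 - ε ≠ 0 := by linarith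
    have hyz : (1 - ε) • ((1 - ε)⁻¹ • (y - ε • x i)) + ε • x i = y := by
      rw [smul_inv_smul₀ h1, sub_add_cancel]
    refine ⟨ε • x i, ⟨x i, hxK i, rfl⟩, _, ⟨(1 - ε)⁻¹ • (y - ε • x i), ?_, rfl⟩,
      (add_comm _ _).trans hyz⟩
    rw [hΔ, b.convexHull_eq_nonneg_coord]
    intro j
    have h2 := b.coord_combo j ((1 - ε)⁻¹ • (y - ε • x i)) (x i) ε
    rw [hyz] at h2
    have h3 := hy j
    exact nonneg_of_mul_nonneg_right (by linarith) (sub_pos.2 hε1)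
  have hεR : ∀ i j, |ε * b.coord j (x i)| ≤ ε * R := fun i j => by
    rw [abs_mul, abs_of_pos hε0]
    exact mul_le_mul_of_nonneg_left (hR i j) hε0.le
  have hcover : T ⊆ L ∪ ⋃ p : {p : ι × ι // p.1 ≠ p.2},
      {y | (∀ k, -(ε * R) ≤ b.coord k y) ∧ b.coord p.1.1 y ≤ ε * R ∧
        b.coord p.1.2 y ≤ ε * R} := by
    intro y hy
    by_cases hyL : y ∈ L
    · exact Or.inl hyL
    right
    -- Membership in `T` already gives the `i`-th inequality of piece `i`, so another one fails.
    -- Applying this twice yields two distinct facets.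
    have hex : ∀ i, ∃ j, j ≠ i ∧ b.coord j y ≤ ε * R := fun i => by
      by_contra! h
      refine hyL (hpiece i y fun j => ?_)
      by_cases hji : j = i
      · subst hji
        exact hy j
      · exact (abs_le.1 (hεR i j)).2.trans (h j hji).le
    obtain ⟨i, -, hi⟩ := hex (Classical.choice b.nonempty)
    obtain ⟨j, hji, hj⟩ := hex i
    exact Set.mem_iUnion.2
      ⟨⟨(i, j), hji.symm⟩, fun k => (abs_le.1 (hεR k k)).1.trans (hy k), hi, hj⟩
  have hTle : μ T ≤ μ L + (∑ p, C p) * ENNReal.ofReal (ε ^ 2) := by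
    refine (measure_mono hcover).trans ((measure_union_le _ _).trans ?_)
    gcongr
    rw [Finset.sum_mul]
    exact (measure_iUnion_fintype_le _ _).trans (Finset.sum_le_sum fun p _ => hεC p)
  have hleT : μ Δ + ENNReal.ofReal (ε * δ) * μ Δ ≤ μ T := by
    have hs : ∑ i, ε * b.coord i (x i) = -(ε * δ) := by
      rw [← Finset.mul_sum, hδ]
      ring
    have hεδ : 0 ≤ ε * δ := by positivity
    refine le_trans ?_ (b.le_measure_coord_ge μ (fun i => ε * b.coord i (x i)) (by linarith))
    rw [← one_add_mul, ← ENNReal.ofReal_one, ← ENNReal.ofReal_add zero_le_one hεδ, hs]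
    gcongr
    rw [sub_neg_eq_add]
    -- Positive dimension gives `1 + εδ ≤ (1 + εδ) ^ n`.
    exact le_self_pow₀ (by linarith) hE.ne'
  have herr : (∑ p, C p) * ENNReal.ofReal (ε ^ 2) < ENNReal.ofReal (ε * δ) * μ Δ := by
    rw [← ENNReal.ofReal_toReal hCsum, ← ENNReal.ofReal_toReal hΔtop,
      ← ENNReal.ofReal_mul ENNReal.toReal_nonneg, ← ENNReal.ofReal_mul (by positivity)]
    refine (ENNReal.ofReal_lt_ofReal_iff_of_nonneg (by positivity)).2 ?_
    nlinarith
  by_contra! hle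
  have h := (hleT.trans hTle).trans (add_le_add_left hle _)
  exact herr.not_ge ((ENNReal.add_le_add_iff_left hΔtop).1 h)

end AffineBasis

/-! ### Shadows and the conclusion. -/

theorem ShadowsContainTranslates.combo {n : ℕ} {A K : Set (Euc n)} (hA : Convex ℝ A)
    (h : ShadowsContainTranslates A K) {t : ℝ} (h0 : 0 ≤ t) (h1 : t ≤ 1) :
    ShadowsContainTranslates A ((1 - t) • K + t • A) := by
  intro u hu
  obtain ⟨w, hw⟩ := h u hu
  refine ⟨(1 - t) • w, ?_⟩
  rintro _ ⟨_, ⟨_, ⟨_, ⟨k, hk, rfl⟩, _, ⟨a, ha, rfl⟩, rfl⟩, rfl⟩, rfl⟩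
  obtain ⟨a', ha', he⟩ := hw ⟨_, ⟨k, hk, rfl⟩, rfl⟩
  refine ⟨(1 - t) • a' + t • a, hA ha' ha (by linarith) h0 (by ring), ?_⟩
  simp only [map_add, map_smul, he, smul_add]
  abel

theorem theorem3p1 (n : ℕ) (s : Affine.Simplex ℝ (Euc n) n) (K : Set (Euc n))
    (hKcompact : IsCompact K) (hKconvex : Convex ℝ K)
    (hshadow : ShadowsContainTranslates (solidSimplex s) K)
    (hnot : ¬ ContainsTranslate (solidSimplex s) K) :
    ∃ t : ℝ, t ∈ Set.Ioo (0 : ℝ) 1 ∧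
      ∃ L : ConvexBody (Euc n),
        (L : Set (Euc n)) = (1 - t) • K + t • solidSimplex s ∧
        ShadowsContainTranslates (solidSimplex s) (L : Set (Euc n)) ∧
        (volume : Measure (Euc n)) (solidSimplex s) < (volume : Measure (Euc n)) (L : Set (Euc n)) := by
  have hKne : K.Nonempty := by
    by_contra h
    rw [Set.not_nonempty_iff_eq_empty] at h
    exact hnot ⟨0, by simp [h]⟩
  have hΔne : (solidSimplex s).Nonempty := (Set.range_nonempty s.points).convexHull
  have hΔcompact : IsCompact (solidSimplex s) := (Set.finite_range s.points).isCompact_convexHull ℝ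
  have hΔconvex : Convex ℝ (solidSimplex s) := convex_convexHull ℝ _
  have hn : 0 < n := by
    rcases Nat.eq_zero_or_pos n with rfl | hn
    -- In dimension 0 the simplex is the whole space.
    · refine absurd ⟨0, fun y _ => ?_⟩ hnot
      obtain ⟨z, hz⟩ := hΔne
      rwa [Subsingleton.elim y z]
    · exact hn
  let b : AffineBasis (Fin (n + 1)) ℝ (Euc n) :=
    ⟨s.points, s.independent, s.span_eq_top (by simp)⟩
  have hvol := b.eventually_measure_lt_combo volume hKcompact (by simpa using hn) hnot
  obtain ⟨ε, hlt, hε⟩ := (hvol.and (Ioo_mem_nhdsGT (zero_lt_one' ℝ))).exists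
  refine ⟨1 - ε, ⟨by linarith [hε.2], by linarith [hε.1]⟩,
    ⟨(1 - (1 - ε)) • K + (1 - ε) • solidSimplex s, (hKconvex.smul _).add (hΔconvex.smul _),
      (hKcompact.smul _).add (hΔcompact.smul _), hKne.smul_set.add hΔne.smul_set⟩, rfl,
    hshadow.combo hΔconvex (by linarith [hε.2]) (by linarith [hε.1]), ?_⟩
  have h1 : 1 - (1 - ε) = ε := by ring
  show volume (solidSimplex s) < volume ((1 - (1 - ε)) • K + (1 - ε) • solidSimplex s)
  rw [h1]
  exact hlt
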